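/- Let $N\in\mathbb{N}$ and $1<p<N$. Let $V:(0,\infty)\to[0,+\infty]$ be measurable with $V\in L^1((r_1,r_2))$ for some $r_2>r_1>0$, and let $K:(0,\infty)\to(0,\infty)$ be measurable with $K\in L^s_{\mathrm{loc}}((0,\infty))$ for some $s>1$. With $p^*=pN/(N-p)$, let $D^{1,p}(\mathbb{R}^N)=\{u\in L^{p^*}(\mathbb{R}^N):\nabla u\in L^p(\mathbb{R}^N)\}$ ($\nabla u$ being the distributional gradient), let $W=D^{1,p}(\mathbb{R}^N)\cap L^p(\mathbb{R}^N,V(|x|)\,dx)$ with the norm $\|u\|=\bigl(\int_{\mathbb{R}^N}(|\nabla u|^p+V(|x|)|u|^p)\,dx\bigr)^{1/p}$, and let $W_r$ be the subspace of the radial functions in $W$. For $q>1$ and $R>0$ set $$\mathcal{R}_0(q,R)=\sup_{u\in W_r,\ h\in W,\ \|u\|=\|h\|=1}\ \int_{|x|<R}K(|x|)\,|u|^{q-1}|h|\,dx\in[0,+\infty].$$ Define $$\alpha^*(\beta)=\max\Bigl\{p\beta-1-\tfrac{p-1}{p}N,\ -(1-\beta)N\Bigr\},\qquad q^*(\alpha,\beta)=p\,\frac{\alpha-p\beta+N}{N-p}.$$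 Assume that there is $R_1>0$ such that $V(r)<+\infty$ for almost every $r\in(0,R_1)$ and $$\operatorname*{ess\,sup}_{r\in(0,R_1)}\frac{K(r)}{r^{\alpha_0}V(r)^{\beta_0}}<+\infty\quad\text{for some }0\le\beta_0\le1\text{ and }\alpha_0>\alpha^*(\beta_0)$$ (with $V(r)^0=1$ for every $r$, and with the quotient equal to $+\infty$ where $V(r)=0$ and $\beta_0>0$). Then $$\lim_{R\to0^+}\mathcal{R}_0(q_1,R)=0\quad\text{for every } q_1\in\mathbb{R}\text{ such that } \max\{1,p\beta_0\}<q_1<q^*(\alpha_0,\beta_0).$$ -/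

import Mathlib

open MeasureTheory Filter Set Topology
open scoped ENNReal NNReal ContDiff

noncomputable section

namespace WeightedRadial

/-- `G` is the distributional gradient of `u` on `ℝ^N`: both are locally integrable and
`∫ u ∂_v φ = -∫ φ ⟨G, v⟩` for every test function `φ` and every direction `v`. -/
def IsWeakGradient {N : ℕ} (u : EuclideanSpace ℝ (Fin N) → ℝ)
    (G : EuclideanSpace ℝ (Fin N) → EuclideanSpace ℝ (Fin N)) : Prop :=
  LocallyIntegrable u volume ∧ LocallyIntegrable G volume ∧
    ∀ φ : EuclideanSpace ℝ (Fin N) → ℝ, ContDiff ℝ ∞ φ → HasCompactSupport φ →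
      ∀ v : EuclideanSpace ℝ (Fin N),
        ∫ x, u x * fderiv ℝ φ x v = -∫ x, φ x * inner ℝ (G x) v

/-- The distributional gradient is unique up to null sets. -/
theorem IsWeakGradient.ae_eq {N : ℕ} {u : EuclideanSpace ℝ (Fin N) → ℝ}
    {G H : EuclideanSpace ℝ (Fin N) → EuclideanSpace ℝ (Fin N)}
    (hG : IsWeakGradient u G) (hH : IsWeakGradient u H) : G =ᵐ[volume] H := by
  have key : ∀ᵐ x ∂(volume : Measure (EuclideanSpace ℝ (Fin N))), G x - H x = 0 := by
    refine ae_eq_zero_of_integral_contDiff_smul_eq_zero (hG.2.1.sub hH.2.1) ?_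
    intro φ hφ hφc
    have hint : ∀ {F : EuclideanSpace ℝ (Fin N) → EuclideanSpace ℝ (Fin N)},
        LocallyIntegrable F volume → Integrable (fun x => φ x • F x) volume :=
      fun hF => hF.integrable_smul_left_of_hasCompactSupport hφ.continuous hφc
    refine ext_inner_right ℝ fun v => ?_
    have h1 : ∀ {F : EuclideanSpace ℝ (Fin N) → EuclideanSpace ℝ (Fin N)},
        LocallyIntegrable F volume →
          inner ℝ (∫ x, φ x • F x) v = ∫ x, φ x * inner ℝ (F x) v := by
      intro F hF
      rw [real_inner_comm, ← integral_inner (hint hF)]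
      refine integral_congr_ae (Eventually.of_forall fun x => ?_)
      simp only [inner_smul_right, real_inner_comm]
    have h2 := (hG.2.2 φ hφ hφc v).symm.trans (hH.2.2 φ hφ hφc v)
    have h3 : ∫ x, φ x • (G x - H x) = (∫ x, φ x • G x) - ∫ x, φ x • H x := by
      rw [← integral_sub (hint hG.2.1) (hint hH.2.1)]
      simp [smul_sub]
    rw [h3, inner_sub_left, h1 hG.2.1, h1 hH.2.1, inner_zero_left]
    linarith
  filter_upwards [key] with x hx
  exact sub_eq_zero.mp hx

open Classical in
/-- A representative of the distributional gradient `∇u` (and `0` if there is none). -/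
def weakGradient {N : ℕ} (u : EuclideanSpace ℝ (Fin N) → ℝ) :
    EuclideanSpace ℝ (Fin N) → EuclideanSpace ℝ (Fin N) :=
  if h : ∃ G, IsWeakGradient u G then h.choose else 0

theorem isWeakGradient_weakGradient {N : ℕ} {u : EuclideanSpace ℝ (Fin N) → ℝ}
    (h : ∃ G, IsWeakGradient u G) : IsWeakGradient u (weakGradient u) := by
  unfold weakGradient
  rw [dif_pos h]
  exact h.choose_spec

/-- `D^{1,p}(ℝ^N) = {u ∈ L^{p^*} : ∇u ∈ L^p}` with `p^* = pN/(N-p)`. -/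
def MemD (N : ℕ) (p : ℝ) (u : EuclideanSpace ℝ (Fin N) → ℝ) : Prop :=
  MemLp u (ENNReal.ofReal (p * N / (N - p))) volume ∧
    (∃ G, IsWeakGradient u G) ∧ MemLp (weakGradient u) (ENNReal.ofReal p) volume

/-- `u` is radial: it agrees almost everywhere with a function of `|x|`. -/
def IsRadial {N : ℕ} (u : EuclideanSpace ℝ (Fin N) → ℝ) : Prop :=
  ∃ f : ℝ → ℝ, u =ᵐ[volume] fun x => f ‖x‖

/-- `W = D^{1,p}(ℝ^N) ∩ L^p(ℝ^N, V(|x|) dx)`. -/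
def W (N : ℕ) (p : ℝ) (V : ℝ → ℝ≥0∞) : Set (EuclideanSpace ℝ (Fin N) → ℝ) :=
  {u | MemD N p u ∧ ∫⁻ x, V ‖x‖ * ‖u x‖ₑ ^ p < ⊤}

/-- `W_r`, the radial functions of `W`. -/
def Wr (N : ℕ) (p : ℝ) (V : ℝ → ℝ≥0∞) : Set (EuclideanSpace ℝ (Fin N) → ℝ) :=
  {u | u ∈ W N p V ∧ IsRadial u}

/-- The norm `‖u‖ = (∫ (|∇u|^p + V(|x|)|u|^p) dx)^{1/p}` of `W`. -/
def normW (N : ℕ) (p : ℝ) (V : ℝ → ℝ≥0∞) (u : EuclideanSpace ℝ (Fin N) → ℝ) : ℝ≥0∞ :=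
  (∫⁻ x, (‖weakGradient u x‖ₑ ^ p + V ‖x‖ * ‖u x‖ₑ ^ p)) ^ (1 / p)

/-- `R_0(q,R)`: the supremum of `∫_{B_R} K(|x|) |u|^{q-1} |h| dx` over `u ∈ W_r`, `h ∈ W` with
`‖u‖ = ‖h‖ = 1`, as an element of `[0,∞]`. -/
def R0 (N : ℕ) (p : ℝ) (V : ℝ → ℝ≥0∞) (K : ℝ → ℝ) (q R : ℝ) : ℝ≥0∞ :=
  ⨆ u ∈ Wr N p V, ⨆ h ∈ W N p V, ⨆ _ : normW N p V u = 1 ∧ normW N p V h = 1,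
    ∫⁻ x in Metric.ball (0 : EuclideanSpace ℝ (Fin N)) R,
      ENNReal.ofReal (K ‖x‖) * ‖u x‖ₑ ^ (q - 1) * ‖h x‖ₑ

/-- The threshold `α^*(β)`. -/
def alphaStar (N : ℕ) (p β : ℝ) : ℝ :=
  max (p * β - 1 - (p - 1) / p * N) (-(1 - β) * N)

/-- The exponent `q^*(α,β)`. -/
def qStar (N : ℕ) (p α β : ℝ) : ℝ :=
  p * ((α - p * β + N) / (N - p))

/-- Condition `(V)`, for the restriction of `V` to `(0,∞)` (other values are never used):
measurable with values in `[0,∞]` and integrable on some interval. -/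
def CondV (V : ℝ → ℝ≥0∞) : Prop :=
  AEMeasurable V (volume.restrict (Ioi 0)) ∧
    ∃ r₁ r₂ : ℝ, 0 < r₁ ∧ r₁ < r₂ ∧ ∫⁻ r in Ioo r₁ r₂, V r < ⊤

/-- Condition `(K)`, for the restriction of `K` to `(0,∞)` (other values are never used):
positive, measurable, and in `L^s_loc((0,∞))` for some `s > 1`. -/
def CondK (K : ℝ → ℝ) : Prop :=
  (∀ r, 0 < r → 0 < K r) ∧ AEMeasurable K (volume.restrict (Ioi 0)) ∧
    ∃ s : ℝ, 1 < s ∧ ∀ a b : ℝ, 0 < a → a < b →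
      MemLp K (ENNReal.ofReal s) (volume.restrict (Icc a b))

end WeightedRadial

end

/-! Write ν = (N-p)/p and p* = pN/(N-p). Near the origin K ≤ Λ r^α V^β, so the integrand is at most
Λ r^α V^β |u|^(q-1) |h|. This is split as (V|h|^p)^a₁ (V|u|^p)^a₂ (|h|^(p*))^a₃ times r^α |u|^m, and
Hölder's inequality is applied with a₁ + a₂ + a₃ + θ = 1. The norm bounds the integrals of the first
two factors and Sobolev's inequality (`exists_sobolev_const`) that of the third. The radial decay
|u| ≤ C r^(-ν) (`exists_radial_const`) turns the rest into the weight r^(α-νm). For θ > 0 its power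
1/θ is integrable at 0 exactly when κ = α - νm + Nθ > 0.

The exponents of `exists_holder_exponents` give κ = ν(q* - q), so the condition is q < q*. What is
left of the power of r yields a bound by a positive power of R (`exists_R0_le`).

Sobolev's inequality and the decay estimate are proved for compactly supported C¹ functions and
carried to D^{1,p} by `exists_approx`: convolution with a radial kernel, then truncation. -/

noncomputable section

namespace WeightedRadial

/-! ### Radial cutoffs and mollifiers. -/

section Cutoff

variable {E : Type*} [NormedAddCommGroup E] [InnerProductSpace ℝ E]

/-- A bump function on the line, equal to `1` on `[-1, 1]` and supported in `[-4, 4]`. -/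
def lineBump : ContDiffBump (0 : ℝ) := ⟨1, 4, one_pos, by norm_num⟩

/-- A smooth radial cutoff, equal to `1` on the ball of radius `R` and supported in the ball of
radius `2 * R`. -/
def cutoff (R : ℝ) (x : E) : ℝ := lineBump (‖R⁻¹ • x‖ ^ 2)

theorem cutoff_eq_comp (R : ℝ) :
    (cutoff R : E → ℝ) = fun x => cutoff 1 (R⁻¹ • x) := by
  funext x
  simp [cutoff]

theorem contDiff_cutoff (R : ℝ) : ContDiff ℝ ∞ (cutoff R : E → ℝ) :=
  lineBump.contDiff.comp ((contDiff_const.smul contDiff_id).norm_sq ℝ)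

theorem cutoff_nonneg (R : ℝ) (x : E) : 0 ≤ cutoff R x := lineBump.nonneg

theorem cutoff_le_one (R : ℝ) (x : E) : cutoff R x ≤ 1 := lineBump.le_one

theorem cutoff_eq_one {R : ℝ} (hR : 0 < R) {x : E} (hx : ‖x‖ ≤ R) : cutoff R x = 1 := by
  refine lineBump.one_of_mem_closedBall ?_
  have h : ‖R⁻¹ • x‖ ≤ 1 := by
    rw [norm_smul, norm_inv, Real.norm_of_nonneg hR.le, inv_mul_le_one₀ hR]
    exact hx
  have h0 := norm_nonneg (R⁻¹ • x)
  change ‖R⁻¹ • x‖ ^ 2 ∈ Metric.closedBall (0 : ℝ) 1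
  rw [mem_closedBall_zero_iff, Real.norm_of_nonneg (by positivity)]
  nlinarith

theorem support_cutoff_subset {R : ℝ} (hR : 0 < R) :
    Function.support (cutoff R : E → ℝ) ⊆ Metric.closedBall 0 (2 * R) := by
  intro x hx
  by_contra hx'
  refine hx (lineBump.zero_of_le_dist ?_)
  rw [mem_closedBall_zero_iff, not_le] at hx'
  have h : 2 ≤ ‖R⁻¹ • x‖ := by
    rw [norm_smul, norm_inv, Real.norm_of_nonneg hR.le, le_inv_mul_iff₀ hR]
    linarith
  change 4 ≤ dist (‖R⁻¹ • x‖ ^ 2) 0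
  rw [dist_zero_right, Real.norm_of_nonneg (by positivity)]
  nlinarith

theorem cutoff_eq_of_norm_eq (R : ℝ) {x y : E} (h : ‖x‖ = ‖y‖) : cutoff R x = cutoff R y := by
  simp [cutoff, norm_smul, h]

variable [FiniteDimensional ℝ E]

theorem hasCompactSupport_cutoff {R : ℝ} (hR : 0 < R) :
    HasCompactSupport (cutoff R : E → ℝ) :=
  HasCompactSupport.of_support_subset_isCompact (isCompact_closedBall _ _)
    (support_cutoff_subset hR)

/-- All cutoffs are dilates of `cutoff 1`, so the chain rule yields the factor R⁻¹ and a constant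
independent of R. -/
theorem exists_norm_fderiv_cutoff_le :
    ∃ C : ℝ≥0, ∀ R : ℝ, 0 < R → ∀ x : E, ‖fderiv ℝ (cutoff R) x‖ ≤ C * R⁻¹ := by
  obtain ⟨C, hC⟩ := (((contDiff_cutoff (E := E) 1).continuous_fderiv
    (by simp))).bounded_above_of_compact_support
      ((hasCompactSupport_cutoff (E := E) one_pos).fderiv ℝ)
  have hC0 : 0 ≤ C := (norm_nonneg _).trans (hC 0)
  refine ⟨⟨C, hC0⟩, fun R hR x => ?_⟩
  rw [cutoff_eq_comp, fderiv_comp_smul, norm_smul, norm_inv, Real.norm_of_nonneg hR.le, mul_comm]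
  exact mul_le_mul_of_nonneg_right (hC _) (by positivity)

variable [MeasurableSpace E] [BorelSpace E]

/-- The normalized cutoff, a smooth radial mollifier supported in the ball of radius `2 * ε`. -/
def mollifier (ε : ℝ) (x : E) : ℝ := cutoff ε x / ∫ y : E, cutoff ε y

theorem integrable_cutoff {ε : ℝ} (hε : 0 < ε) : Integrable (cutoff ε : E → ℝ) :=
  (contDiff_cutoff ε).continuous.integrable_of_hasCompactSupport (hasCompactSupport_cutoff hε)

theorem measureReal_ball_le_integral_cutoff {ε : ℝ} (hε : 0 < ε) :
    volume.real (Metric.closedBall (0 : E) ε) ≤ ∫ y : E, cutoff ε y := by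
  have h : ∫ y : E, (Metric.closedBall (0 : E) ε).indicator (fun _ => (1 : ℝ)) y =
      volume.real (Metric.closedBall (0 : E) ε) := by
    rw [integral_indicator Metric.isClosed_closedBall.measurableSet]
    simp
  rw [← h]
  refine integral_mono ?_ (integrable_cutoff hε) fun y => ?_
  · exact (integrable_indicator_iff Metric.isClosed_closedBall.measurableSet).2
      (integrableOn_const (isCompact_closedBall _ _).measure_lt_top.ne)
  · by_cases hy : y ∈ Metric.closedBall (0 : E) ε
    · rw [indicator_of_mem hy, cutoff_eq_one hε (mem_closedBall_zero_iff.1 hy)]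
    · rw [indicator_of_notMem hy]
      exact cutoff_nonneg _ _

theorem integral_cutoff_pos {ε : ℝ} (hε : 0 < ε) : 0 < ∫ y : E, cutoff ε y :=
  lt_of_lt_of_le (ENNReal.toReal_pos (Metric.measure_closedBall_pos volume _ hε).ne'
    (isCompact_closedBall _ _).measure_lt_top.ne) (measureReal_ball_le_integral_cutoff hε)

theorem contDiff_mollifier (ε : ℝ) : ContDiff ℝ ∞ (mollifier ε : E → ℝ) :=
  (contDiff_cutoff ε).div_const _

theorem mollifier_nonneg (ε : ℝ) (x : E) : 0 ≤ mollifier ε x :=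
  div_nonneg (cutoff_nonneg _ _) (integral_nonneg fun _ => cutoff_nonneg _ _)

theorem mollifier_eq_of_norm_eq (ε : ℝ) {x y : E} (h : ‖x‖ = ‖y‖) :
    mollifier ε x = mollifier ε y := by
  simp [mollifier, cutoff_eq_of_norm_eq ε h]

theorem support_mollifier_subset {ε : ℝ} (hε : 0 < ε) :
    Function.support (mollifier ε : E → ℝ) ⊆ Metric.closedBall 0 (2 * ε) := fun x hx =>
  support_cutoff_subset hε fun h => hx (by simp [mollifier, h])

theorem hasCompactSupport_mollifier {ε : ℝ} (hε : 0 < ε) :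
    HasCompactSupport (mollifier ε : E → ℝ) :=
  HasCompactSupport.of_support_subset_isCompact (isCompact_closedBall _ _)
    (support_mollifier_subset hε)

theorem integral_mollifier {ε : ℝ} (hε : 0 < ε) : ∫ x : E, mollifier ε x = 1 := by
  simp only [mollifier, integral_div]
  exact div_self (integral_cutoff_pos hε).ne'

theorem lintegral_mollifier {ε : ℝ} (hε : 0 < ε) (x : E) :
    ∫⁻ t : E, ENNReal.ofReal (mollifier ε (x - t)) = 1 := by
  rw [lintegral_sub_left_eq_self (fun t : E => ENNReal.ofReal (mollifier ε t)) x,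
    ← ofReal_integral_eq_lintegral_ofReal
    ((contDiff_mollifier ε).continuous.integrable_of_hasCompactSupport
      (hasCompactSupport_mollifier hε)) (Eventually.of_forall fun _ => mollifier_nonneg _ _),
    integral_mollifier hε, ENNReal.ofReal_one]

/-- The factor 2^n is the volume ratio of balls of radii 2ε and ε. A bound by the inverse volume of
the supporting ball is what convergence at Lebesgue points needs; the centre y is free by
translation invariance. -/
theorem abs_mollifier_le {ε : ℝ} (hε : 0 < ε) (x y : E) :
    |mollifier ε x| ≤ 2 ^ Module.finrank ℝ E / volume.real (Metric.closedBall y (2 * ε)) := by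
  have h1 : 0 < volume.real (Metric.closedBall (0 : E) ε) :=
    ENNReal.toReal_pos (Metric.measure_closedBall_pos volume _ hε).ne'
      (isCompact_closedBall _ _).measure_lt_top.ne
  have h2 : volume.real (Metric.closedBall y (2 * ε)) =
      2 ^ Module.finrank ℝ E * volume.real (Metric.closedBall (0 : E) ε) := by
    rw [Measure.addHaar_real_closedBall _ _ (by positivity),
      Measure.addHaar_real_closedBall _ (0 : E) hε.le, mul_pow]
    ring
  rw [abs_of_nonneg (mollifier_nonneg _ _), h2, div_mul_eq_div_div, div_self (by positivity)]
  exact div_le_div₀ zero_le_one (cutoff_le_one _ _) h1 (measureReal_ball_le_integral_cutoff hε)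

end Cutoff

/-! ### Mollification: L^p bounds, almost everywhere convergence, radial symmetry, weak gradients.
-/

section Mollify

variable {E : Type*} [NormedAddCommGroup E] [InnerProductSpace ℝ E] [FiniteDimensional ℝ E]
  [MeasurableSpace E] [BorelSpace E]

/-- Young's inequality for a kernel of mass one. -/
theorem lintegral_kernel_rpow_le {k f : E → ℝ≥0∞} (hk : Measurable k)
    (hk1 : ∀ x, ∫⁻ t, k (x - t) = 1) (hf : AEMeasurable f) {p : ℝ} (hp : 1 ≤ p) :
    ∫⁻ x, (∫⁻ t, k (x - t) * f t) ^ p ≤ ∫⁻ t, f t ^ p := by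
  have hp0 : 0 < p := by linarith
  have jensen : ∀ x, (∫⁻ t, k (x - t) * f t) ^ p ≤ ∫⁻ t, k (x - t) * f t ^ p := by
    intro x
    have hkx : Measurable fun t => k (x - t) := hk.comp (measurable_const.sub measurable_id)
    -- Jensen's inequality is obtained as monotonicity of L^p norms, from exponent 1 to p, for the
    -- probability measure k(x - t) dt.
    have : IsProbabilityMeasure (volume.withDensity fun t => k (x - t)) :=
      ⟨by rw [withDensity_apply _ MeasurableSet.univ, Measure.restrict_univ, hk1]⟩
    have hf' : AEMeasurable f (volume.withDensity fun t => k (x - t)) :=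
      hf.mono_ac (withDensity_absolutelyContinuous _ _)
    have h := eLpNorm'_le_eLpNorm'_of_exponent_le zero_lt_one hp
      (volume.withDensity fun t => k (x - t)) hf'.aestronglyMeasurable
    simp only [eLpNorm', enorm_eq_self, ENNReal.rpow_one, div_one] at h
    rw [lintegral_withDensity_eq_lintegral_mul₀ hkx.aemeasurable hf,
      lintegral_withDensity_eq_lintegral_mul₀ hkx.aemeasurable (hf.pow_const p)] at h
    simp only [Pi.mul_apply] at h
    calc _ ≤ ((∫⁻ t, k (x - t) * f t ^ p) ^ (1 / p)) ^ p :=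
          ENNReal.rpow_le_rpow h hp0.le
      _ = _ := by rw [← ENNReal.rpow_mul, one_div_mul_cancel hp0.ne', ENNReal.rpow_one]
  calc _ ≤ ∫⁻ x, ∫⁻ t, k (x - t) * f t ^ p := lintegral_mono jensen
    _ = ∫⁻ t, ∫⁻ x, k (x - t) * f t ^ p := by
        refine lintegral_lintegral_swap ?_
        exact (hk.comp measurable_sub).aemeasurable.mul
          ((hf.pow_const p).comp_quasiMeasurePreserving Measure.quasiMeasurePreserving_snd)
    _ = ∫⁻ t, f t ^ p := by
        refine lintegral_congr fun t => ?_
        rw [lintegral_mul_const _ (show Measurable fun x => k (x - t) from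
            hk.comp (measurable_id.sub measurable_const)),
          lintegral_sub_right_eq_self k t]
        have := hk1 0
        rw [lintegral_sub_left_eq_self k 0] at this
        rw [this, one_mul]

/-- The mollification of `u` at scale `ε`. -/
def mollify (ε : ℝ) (u : E → ℝ) : E → ℝ :=
  convolution u (mollifier ε) (ContinuousLinearMap.lsmul ℝ ℝ) volume

theorem mollify_apply (ε : ℝ) (u : E → ℝ) (x : E) :
    mollify ε u x = ∫ t, mollifier ε (x - t) * u t := by
  simp [mollify, convolution, mul_comm]

theorem contDiff_mollify {ε : ℝ} (hε : 0 < ε) {u : E → ℝ} (hu : LocallyIntegrable u) :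
    ContDiff ℝ 1 (mollify ε u) :=
  (hasCompactSupport_mollifier hε).contDiff_convolution_right (n := 1) _ hu
    ((contDiff_mollifier ε).of_le (by simp))

/-- Convergence holds at every Lebesgue point of u, since the kernels have mass one and are
dominated by averages over shrinking balls. -/
theorem ae_tendsto_mollify {ι : Type*} {l : Filter ι} {ε : ι → ℝ} (hε : ∀ i, 0 < ε i)
    (hε' : Tendsto ε l (𝓝 0)) {u : E → ℝ} (hu : LocallyIntegrable u) :
    ∀ᵐ x, Tendsto (fun i => mollify (ε i) u x) l (𝓝 (u x)) := by
  filter_upwards [(Besicovitch.vitaliFamily (volume : Measure E)).ae_tendsto_average_norm_sub hu]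
    with x hx
  have h1 : Tendsto (fun i => 2 * ε i) l (𝓝[>] 0) :=
    tendsto_nhdsWithin_iff.2 ⟨by simpa using hε'.const_mul 2,
      Eventually.of_forall fun i => mul_pos two_pos (hε i)⟩
  have h2 := (hx.comp (Besicovitch.tendsto_filterAt volume x)).comp h1
  simp only [mollify_apply, ← smul_eq_mul (a := mollifier _ _)]
  refine tendsto_integral_smul_of_tendsto_average_norm_sub (2 ^ Module.finrank ℝ E) h2
    (Eventually.of_forall fun i => hu.integrableOn_isCompact (isCompact_closedBall _ _))
    (tendsto_const_nhds.congr fun i => ?_) (Eventually.of_forall fun i t ht => ?_)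
    (Eventually.of_forall fun i t => abs_mollifier_le (hε i) _ _)
  · rw [integral_sub_left_eq_self (fun t => mollifier (ε i) t) volume x, integral_mollifier (hε i)]
  · have := support_mollifier_subset (hε i) (show x - t ∈ Function.support (mollifier (ε i)) from ht)
    rwa [mem_closedBall_zero_iff, ← dist_eq_norm, dist_comm, ← Metric.mem_closedBall] at this

/-- The reflection across the hyperplane orthogonal to x - y sends x to y. It preserves the measure
and all norms, hence the radial kernel and the radial function. -/
theorem mollify_eq_of_norm_eq (ε : ℝ) {u : E → ℝ} {f : ℝ → ℝ} (hu : u =ᵐ[volume] fun x => f ‖x‖)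
    {x y : E} (h : ‖x‖ = ‖y‖) : mollify ε u x = mollify ε u y := by
  have h0 : ∀ z : E, mollify ε u z = ∫ t, mollifier ε (z - t) * f ‖t‖ := by
    intro z
    rw [mollify_apply]
    refine integral_congr_ae ?_
    filter_upwards [hu] with t ht
    rw [ht]
  set L := (ℝ ∙ (x - y))ᗮ.reflection with hL
  have hLx : L x = y := Submodule.reflection_sub h
  rw [h0, h0, ← hLx, ← L.measurePreserving.integral_comp L.toHomeomorph.measurableEmbedding
    (fun t => mollifier ε (L x - t) * f ‖t‖)]
  refine integral_congr_ae (Eventually.of_forall fun t => ?_)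
  simp only
  rw [← map_sub, mollifier_eq_of_norm_eq ε (L.norm_map (x - t)), L.norm_map]

theorem enorm_integral_mollifier_smul_le (ε : ℝ) {F : Type*} [NormedAddCommGroup F]
    [NormedSpace ℝ F] (u : E → F) (x : E) :
    ‖∫ t, mollifier ε (x - t) • u t‖ₑ ≤ ∫⁻ t, ENNReal.ofReal (mollifier ε (x - t)) * ‖u t‖ₑ := by
  refine (enorm_integral_le_lintegral_enorm _).trans_eq (lintegral_congr fun t => ?_)
  rw [enorm_smul, Real.enorm_of_nonneg (mollifier_nonneg _ _)]

theorem eLpNorm_integral_mollifier_smul_le {ε : ℝ} (hε : 0 < ε) {F : Type*} [NormedAddCommGroup F]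
    [NormedSpace ℝ F] {u : E → F} (hu : AEStronglyMeasurable u) {p : ℝ} (hp : 1 ≤ p) :
    eLpNorm (fun x => ∫ t, mollifier ε (x - t) • u t) (ENNReal.ofReal p) volume ≤
      eLpNorm u (ENNReal.ofReal p) volume := by
  have hp0 : 0 < p := by linarith
  have h0 : ENNReal.ofReal p ≠ 0 := by simpa using hp0
  rw [eLpNorm_eq_lintegral_rpow_enorm_toReal h0 ENNReal.ofReal_ne_top,
    eLpNorm_eq_lintegral_rpow_enorm_toReal h0 ENNReal.ofReal_ne_top, ENNReal.toReal_ofReal hp0.le]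
  refine ENNReal.rpow_le_rpow ?_ (by positivity)
  refine le_trans (lintegral_mono fun x => ENNReal.rpow_le_rpow
    (enorm_integral_mollifier_smul_le ε u x) hp0.le) ?_
  exact lintegral_kernel_rpow_le (k := fun t => ENNReal.ofReal (mollifier ε t))
    (contDiff_mollifier ε).continuous.measurable.ennreal_ofReal (lintegral_mollifier hε)
    hu.enorm hp

end Mollify

/-- The weak gradient identity is tested on t ↦ `mollifier ε (x - t)`: the sign from differentiating
in t rather than in x cancels the sign of the integration by parts. -/
theorem fderiv_mollify {N : ℕ} {ε : ℝ} (hε : 0 < ε) {u : EuclideanSpace ℝ (Fin N) → ℝ}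
    {G : EuclideanSpace ℝ (Fin N) → EuclideanSpace ℝ (Fin N)} (hG : IsWeakGradient u G)
    (x : EuclideanSpace ℝ (Fin N)) :
    fderiv ℝ (mollify ε u) x = innerSL ℝ (∫ t, mollifier ε (x - t) • G t) := by
  have hc := hasCompactSupport_mollifier (E := EuclideanSpace ℝ (Fin N)) hε
  have hd := contDiff_mollifier (E := EuclideanSpace ℝ (Fin N)) ε
  have hφ : ContDiff ℝ ∞ fun t => mollifier ε (x - t) := hd.comp (contDiff_const.sub contDiff_id)
  have hφc : HasCompactSupport fun t => mollifier ε (x - t) :=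
    hc.comp_homeomorph (Homeomorph.subLeft x)
  have hD := (hc.hasFDerivAt_convolution_right (ContinuousLinearMap.lsmul ℝ ℝ) hG.1
    (hd.of_le (by simp)) x).fderiv
  ext v
  have h1 : fderiv ℝ (mollify ε u) x v = ∫ t, u t * fderiv ℝ (mollifier ε) (x - t) v := by
    unfold mollify
    rw [hD, convolution_precompR_apply _ hG.1 (hc.fderiv ℝ) (hd.continuous_fderiv (by simp))]
    simp [convolution]
  have h2 : ∀ t, fderiv ℝ (fun t => mollifier ε (x - t)) t v =
      -fderiv ℝ (mollifier ε) (x - t) v := by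
    intro t
    have hf : HasFDerivAt (fun t => mollifier ε (x - t)) _ t :=
      (hd.differentiable (by simp) (x - t)).hasFDerivAt.comp t ((hasFDerivAt_id t).const_sub x)
    rw [hf.fderiv]
    simp
  have h3 := hG.2.2 _ hφ hφc v
  simp only [h2, mul_neg, integral_neg, neg_inj] at h3
  rw [h1, h3, innerSL_apply_apply, real_inner_comm, ← integral_inner
    (hG.2.1.integrable_smul_left_of_hasCompactSupport hφ.continuous hφc)]
  refine integral_congr_ae (Eventually.of_forall fun t => ?_)
  simp only [inner_smul_right, real_inner_comm]

theorem eLpNorm_mollify_le {N : ℕ} {ε : ℝ} (hε : 0 < ε) {u : EuclideanSpace ℝ (Fin N) → ℝ}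
    (hu : AEStronglyMeasurable u) {p : ℝ} (hp : 1 ≤ p) :
    eLpNorm (mollify ε u) (ENNReal.ofReal p) volume ≤ eLpNorm u (ENNReal.ofReal p) volume := by
  have := eLpNorm_integral_mollifier_smul_le hε hu hp
  simpa only [smul_eq_mul, ← mollify_apply] using this

theorem eLpNorm_fderiv_mollify_le {N : ℕ} {ε : ℝ} (hε : 0 < ε)
    {u : EuclideanSpace ℝ (Fin N) → ℝ}
    {G : EuclideanSpace ℝ (Fin N) → EuclideanSpace ℝ (Fin N)} (hG : IsWeakGradient u G)
    {p : ℝ} (hp : 1 ≤ p) :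
    eLpNorm (fderiv ℝ (mollify ε u)) (ENNReal.ofReal p) volume ≤
      eLpNorm G (ENNReal.ofReal p) volume := by
  refine le_trans (eLpNorm_mono fun x => ?_)
    (eLpNorm_integral_mollifier_smul_le hε hG.2.1.aestronglyMeasurable hp)
  rw [fderiv_mollify hε hG, innerSL_apply_norm]

/-! ### Truncation and approximation by compactly supported C¹ functions; Sobolev's inequality. -/

section

variable {E : Type*} [NormedAddCommGroup E] [InnerProductSpace ℝ E]

theorem fderiv_cutoff_eq_zero {R : ℝ} (hR : 0 < R) {x : E} (hx : ‖x‖ < R) :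
    fderiv ℝ (cutoff R) x = 0 := by
  have h : (cutoff R : E → ℝ) =ᶠ[𝓝 x] fun _ => 1 := by
    filter_upwards [continuous_norm.continuousAt.eventually (gt_mem_nhds hx)] with y hy
    exact cutoff_eq_one hR hy.le
  rw [h.fderiv_eq, fderiv_fun_const, Pi.zero_apply]

variable [FiniteDimensional ℝ E] [MeasurableSpace E] [BorelSpace E]

/-- The L^n norm of a gradient is scale invariant in dimension n: the gradient is of size R⁻¹ on a
ball whose volume is of order R^n. -/
theorem exists_eLpNorm_fderiv_cutoff_le (hE : 0 < Module.finrank ℝ E) :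
    ∃ A : ℝ≥0, ∀ R : ℝ, 0 < R →
      eLpNorm (fderiv ℝ (cutoff R : E → ℝ)) (ENNReal.ofReal (Module.finrank ℝ E)) volume ≤ A := by
  obtain ⟨C, hC⟩ := exists_norm_fderiv_cutoff_le (E := E)
  set n := Module.finrank ℝ E with hn
  have hn0 : (n : ℝ) ≠ 0 := by exact_mod_cast hE.ne'
  set v := volume (Metric.ball (0 : E) 1) ^ (n : ℝ)⁻¹ with hv
  have hvt : v ≠ ⊤ := ENNReal.rpow_ne_top_of_nonneg (by positivity) measure_ball_lt_top.ne
  refine ⟨(ENNReal.ofReal 2 * v * C).toNNReal, fun R hR => ?_⟩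
  rw [ENNReal.coe_toNNReal (by finiteness)]
  have hsupp : Function.support (fun x => ‖fderiv ℝ (cutoff R : E → ℝ) x‖) ⊆
      Metric.closedBall 0 (2 * R) := fun x hx =>
    closure_minimal (support_cutoff_subset hR) Metric.isClosed_closedBall
      (support_fderiv_subset ℝ fun h => hx (by simp [h]))
  rw [← eLpNorm_norm, ← eLpNorm_restrict_eq_of_support_subset hsupp]
  refine (eLpNorm_le_of_ae_bound (C := C * R⁻¹) (Eventually.of_forall fun x => ?_)).trans_eq ?_
  · rw [norm_norm]
    exact hC R hR x
  rw [Measure.restrict_apply_univ, ENNReal.toReal_ofReal (by positivity),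
    Measure.addHaar_closedBall _ _ (by positivity), ENNReal.mul_rpow_of_nonneg _ _ (by positivity),
    ENNReal.ofReal_rpow_of_nonneg (by positivity) (by positivity), ← hn,
    Real.pow_rpow_inv_natCast (by positivity) hE.ne', ENNReal.ofReal_mul C.coe_nonneg,
    ENNReal.ofReal_mul two_pos.le, ← hv]
  have : ENNReal.ofReal R * ENNReal.ofReal R⁻¹ = 1 := by
    rw [← ENNReal.ofReal_mul hR.le, mul_inv_cancel₀ hR.ne', ENNReal.ofReal_one]
  rw [ENNReal.ofReal_coe_nnreal]
  calc _ = ENNReal.ofReal 2 * v * C * (ENNReal.ofReal R * ENNReal.ofReal R⁻¹) := by ring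
    _ = _ := by rw [this, mul_one]

/-- This controls the error of truncation. The gradient of the cutoff vanishes on the ball of radius
R, so u may be replaced by u - g with g compactly supported and close to u in L^q. Hölder's
inequality with the uniform L^n bound then makes the product small. -/
theorem exists_eLpNorm_smul_fderiv_cutoff_le (hE : 0 < Module.finrank ℝ E) {p q : ℝ}
    (hpq : Real.HolderTriple q (Module.finrank ℝ E) p) {u : E → ℝ}
    (hu : MemLp u (ENNReal.ofReal q)) {δ : ℝ≥0∞} (hδ : δ ≠ 0) (M : ℝ) :
    ∃ R : ℝ, 0 < R ∧ M ≤ R ∧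
      eLpNorm (fun x => u x • fderiv ℝ (cutoff R) x) (ENNReal.ofReal p) volume ≤ δ := by
  obtain ⟨A, hA⟩ := exists_eLpNorm_fderiv_cutoff_le hE
  -- The divisor is A + 1 because A may vanish.
  obtain ⟨g, hgc, hug, hg, -⟩ := hu.exists_hasCompactSupport_eLpNorm_sub_le ENNReal.ofReal_ne_top
    (ε := δ / (A + 1)) (ENNReal.div_ne_zero.2 ⟨hδ, by finiteness⟩)
  obtain ⟨R₀, hR₀⟩ := hgc.isCompact.isBounded.subset_ball 0
  set R := max (max 1 M) R₀ with hR
  have hR0 : 0 < R := one_pos.trans_le ((le_max_left 1 M).trans (le_max_left _ _))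
  refine ⟨R, hR0, (le_max_right 1 M).trans (le_max_left _ _), ?_⟩
  have h : (fun x => u x • fderiv ℝ (cutoff R) x) = (u - g) • fderiv ℝ (cutoff R) := by
    funext x
    by_cases hx : ‖x‖ < R
    · simp [fderiv_cutoff_eq_zero hR0 hx]
    · have : g x = 0 := by
        by_contra hgx
        exact hx ((mem_ball_zero_iff.1 (hR₀ (subset_tsupport _ hgx))).trans_le (le_max_right _ _))
      simp [this]
  have := hpq.ennrealOfReal
  have hc := (contDiff_cutoff (E := E) R).continuous_fderiv (by simp)
  rw [h]
  calc _ ≤ eLpNorm (u - g) (ENNReal.ofReal q) volume *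
          eLpNorm (fderiv ℝ (cutoff R : E → ℝ)) (ENNReal.ofReal (Module.finrank ℝ E)) volume :=
        eLpNorm_smul_le_mul_eLpNorm hc.aestronglyMeasurable
          (hu.1.sub hg.aestronglyMeasurable)
    _ ≤ δ / (A + 1) * (A + 1) := mul_le_mul' hug ((hA R hR0).trans le_self_add)
    _ = δ := ENNReal.div_mul_cancel (by simp) (by finiteness)

end

/-- Functions of `D^{1,p}` are limits almost everywhere of compactly supported `C^1` functions
whose gradients are asymptotically no larger in `L^p`; radial functions have radial approximants. -/
theorem exists_approx {N : ℕ} {p : ℝ} (hp : 1 < p) (hpN : p < N)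
    {u : EuclideanSpace ℝ (Fin N) → ℝ} {G : EuclideanSpace ℝ (Fin N) → EuclideanSpace ℝ (Fin N)}
    (hu : MemLp u (ENNReal.ofReal (p * N / (N - p)))) (hG : IsWeakGradient u G) :
    ∃ w : ℕ → EuclideanSpace ℝ (Fin N) → ℝ,
      (∀ n, ContDiff ℝ 1 (w n)) ∧ (∀ n, HasCompactSupport (w n)) ∧
      (∀ᵐ x, Tendsto (fun n => w n x) atTop (𝓝 (u x))) ∧
      (∀ n, eLpNorm (fderiv ℝ (w n)) (ENNReal.ofReal p) volume ≤
        eLpNorm G (ENNReal.ofReal p) volume + (n : ℝ≥0∞)⁻¹) ∧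
      (IsRadial u → ∀ n x y, ‖x‖ = ‖y‖ → w n x = w n y) := by
  have hNp : 0 < (N : ℝ) - p := sub_pos.2 hpN
  have hp0 : 0 < p := by linarith
  have hN0 : (0 : ℝ) < N := by linarith
  have hfin : Module.finrank ℝ (EuclideanSpace ℝ (Fin N)) = N := finrank_euclideanSpace_fin
  have hq1 : 1 ≤ p * N / (N - p) := by
    rw [le_div_iff₀ hNp]
    nlinarith
  have htriple : Real.HolderTriple (p * N / (N - p))
      (Module.finrank ℝ (EuclideanSpace ℝ (Fin N))) p := by
    rw [hfin]
    refine ⟨?_, by positivity, hN0⟩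
    field_simp
    ring
  set ε : ℕ → ℝ := fun n => 1 / ((n : ℝ) + 1) with hεdef
  have hε : ∀ n, 0 < ε n := fun n => by positivity
  have hlim := ae_tendsto_mollify hε tendsto_one_div_add_atTop_nhds_zero_nat hG.1
  have hmol : ∀ n, ContDiff ℝ 1 (mollify (ε n) u) := fun n => contDiff_mollify (hε n) hG.1
  have hmem : ∀ n, MemLp (mollify (ε n) u) (ENNReal.ofReal (p * N / (N - p))) := fun n =>
    ⟨(hmol n).continuous.aestronglyMeasurable, (eLpNorm_mollify_le (hε n) hu.1 hq1).trans_lt hu.2⟩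
  have hR : ∀ n : ℕ, ∃ R : ℝ, 0 < R ∧ (n : ℝ) ≤ R ∧
      eLpNorm (fun x => mollify (ε n) u x • fderiv ℝ (cutoff R) x) (ENNReal.ofReal p) volume ≤
        (n : ℝ≥0∞)⁻¹ := fun n =>
    exists_eLpNorm_smul_fderiv_cutoff_le (by rw [hfin]; exact_mod_cast hN0) htriple (hmem n)
      (by simp) n
  choose R hR0 hRn hRδ using hR
  have hcut : ∀ n, ContDiff ℝ 1 (cutoff (R n) : EuclideanSpace ℝ (Fin N) → ℝ) := fun n =>
    (contDiff_cutoff (R n)).of_le (by simp)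
  refine ⟨fun n x => cutoff (R n) x * mollify (ε n) u x, fun n => (hcut n).mul (hmol n),
    fun n => (hasCompactSupport_cutoff (hR0 n)).mul_right, ?_, fun n => ?_, ?_⟩
  · filter_upwards [hlim] with x hx
    refine hx.congr' ?_
    obtain ⟨m, hm⟩ := exists_nat_ge ‖x‖
    filter_upwards [eventually_ge_atTop m] with n hn
    rw [cutoff_eq_one (hR0 n) (hm.trans ((Nat.cast_le.2 hn).trans (hRn n))), one_mul]
  · have hD : fderiv ℝ (fun x => cutoff (R n) x * mollify (ε n) u x) =
        (fun x => cutoff (R n) x • fderiv ℝ (mollify (ε n) u) x) +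
          fun x => mollify (ε n) u x • fderiv ℝ (cutoff (R n)) x := by
      funext x
      exact fderiv_fun_mul ((hcut n).differentiable (by simp) x)
        ((hmol n).differentiable (by simp) x)
    have hc1 := (hcut n).continuous
    have hc2 := (hmol n).continuous
    have hc3 := (hcut n).continuous_fderiv (by simp)
    have hc4 := (hmol n).continuous_fderiv (by simp)
    rw [hD]
    refine (eLpNorm_add_le (hc1.smul hc4).aestronglyMeasurable
      (hc2.smul hc3).aestronglyMeasurable (by simpa using hp.le)).trans (add_le_add ?_ (hRδ n))
    refine le_trans (eLpNorm_mono fun x => ?_) (eLpNorm_fderiv_mollify_le (hε n) hG hp.le)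
    simp only [Pi.smul_apply', norm_smul, Real.norm_of_nonneg (cutoff_nonneg _ _)]
    exact mul_le_of_le_one_left (norm_nonneg _) (cutoff_le_one _ _)
  · rintro ⟨f, hf⟩ n x y hxy
    simp only [cutoff_eq_of_norm_eq (R n) hxy, mollify_eq_of_norm_eq (ε n) hf hxy]

/-- The Sobolev inequality on `D^{1,p}`. -/
theorem exists_sobolev_const (N : ℕ) {p : ℝ} (hp : 1 < p) (hpN : p < N) :
    ∃ S : ℝ≥0, ∀ u : EuclideanSpace ℝ (Fin N) → ℝ, MemD N p u →
      eLpNorm u (ENNReal.ofReal (p * N / (N - p))) volume ≤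
        S * eLpNorm (weakGradient u) (ENNReal.ofReal p) volume := by
  have hNp : 0 < (N : ℝ) - p := sub_pos.2 hpN
  have hp0 : 0 < p := by linarith
  have hN0 : (0 : ℝ) < N := by linarith
  have hfin : Module.finrank ℝ (EuclideanSpace ℝ (Fin N)) = N := finrank_euclideanSpace_fin
  refine ⟨SNormLESNormFDerivOfEqConst ℝ (volume : Measure (EuclideanSpace ℝ (Fin N)))
    p.toNNReal, fun u hu => ?_⟩
  set S := SNormLESNormFDerivOfEqConst ℝ (volume : Measure (EuclideanSpace ℝ (Fin N))) p.toNNReal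
  obtain ⟨w, hw1, hwc, hlim, hgrad, -⟩ :=
    exists_approx hp hpN hu.1 (isWeakGradient_weakGradient hu.2.1)
  have hsob : ∀ n, eLpNorm (w n) (ENNReal.ofReal (p * N / (N - p))) volume ≤
      S * (eLpNorm (weakGradient u) (ENNReal.ofReal p) volume + (n : ℝ≥0∞)⁻¹) := by
    intro n
    refine le_trans ?_ (mul_le_mul_right (hgrad n) _)
    refine eLpNorm_le_eLpNorm_fderiv_of_eq volume (hw1 n) (hwc n)
      (by rw [Real.one_le_toNNReal]; exact hp.le) (by rw [hfin]; exact_mod_cast hN0) ?_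
    rw [Real.coe_toNNReal _ (by positivity), NNReal.coe_inv, Real.coe_toNNReal _ hp0.le, hfin]
    field_simp
  -- Fatou's lemma: convergence almost everywhere suffices to pass to the limit on the left.
  refine (Lp.eLpNorm_lim_le_liminf_eLpNorm
    (fun n => (hw1 n).continuous.aestronglyMeasurable) u hlim).trans ?_
  refine (liminf_le_liminf (Eventually.of_forall hsob)).trans_eq (Tendsto.liminf_eq ?_)
  have h := ENNReal.Tendsto.const_mul (a := (S : ℝ≥0∞))
    ((tendsto_const_nhds (x := eLpNorm (weakGradient u) (ENNReal.ofReal p) volume)).add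
      ENNReal.tendsto_inv_nat_nhds_zero) (Or.inr ENNReal.coe_ne_top)
  simpa using h

/-! ### Polar coordinates and the decay of radial functions. -/

section

variable {E : Type*} [NormedAddCommGroup E] [NormedSpace ℝ E] [FiniteDimensional ℝ E]
  [MeasurableSpace E] [BorelSpace E] [Nontrivial E]

theorem lintegral_fun_norm (μ : Measure E) [μ.IsAddHaarMeasure] {f : ℝ → ℝ≥0∞}
    (hf : Measurable f) :
    ∫⁻ x, f ‖x‖ ∂μ = μ.toSphere univ *
      ∫⁻ r in Ioi (0 : ℝ), ENNReal.ofReal (r ^ (Module.finrank ℝ E - 1)) * f r := by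
  calc ∫⁻ x, f ‖x‖ ∂μ = ∫⁻ x : ({(0)}ᶜ : Set E), f ‖x.1‖ ∂(μ.comap (↑)) := by
        rw [lintegral_subtype_comap (measurableSet_singleton _).compl fun x ↦ f ‖x‖,
          restrict_compl_singleton]
    _ = ∫⁻ x, f x.2 ∂μ.toSphere.prod (.volumeIoiPow (Module.finrank ℝ E - 1)) := by
        simpa using μ.measurePreserving_homeomorphUnitSphereProd.lintegral_comp_emb
          (Homeomorph.measurableEmbedding _) (f ∘ Subtype.val ∘ Prod.snd)
    _ = μ.toSphere univ * ∫⁻ r, f r ∂(.volumeIoiPow (Module.finrank ℝ E - 1)) := by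
        rw [lintegral_prod _ (by fun_prop)]
        simp [mul_comm]
    _ = _ := by
        congr 1
        rw [Measure.volumeIoiPow, lintegral_withDensity_eq_lintegral_mul _ (by fun_prop)
          (by fun_prop)]
        exact lintegral_subtype_comap measurableSet_Ioi
          fun r => ENNReal.ofReal (r ^ (Module.finrank ℝ E - 1)) * f r

/-- This transfers measurability and almost everywhere statements about V and K from radii to points
of the space. -/
theorem quasiMeasurePreserving_norm (μ : Measure E) [μ.IsAddHaarMeasure] :
    Measure.QuasiMeasurePreserving (fun x : E => ‖x‖) μ (volume.restrict (Ioi 0)) := by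
  refine ⟨measurable_norm, Measure.AbsolutelyContinuous.mk fun s hs h0 => ?_⟩
  rw [Measure.map_apply measurable_norm hs, ← lintegral_indicator_one (measurable_norm hs)]
  have h := lintegral_fun_norm μ (f := s.indicator 1) (measurable_one.indicator hs)
  change ∫⁻ x, (s.indicator 1 : ℝ → ℝ≥0∞) ‖x‖ ∂μ = 0
  rw [h, mul_eq_zero]
  right
  refine (lintegral_eq_zero_iff' (by fun_prop (disch := assumption))).2 ?_
  have : ∀ᵐ r ∂(volume.restrict (Ioi (0 : ℝ))), r ∉ s := by
    exact measure_eq_zero_iff_ae_notMem.1 h0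
  filter_upwards [this] with r hr
  simp [hr]

end

/-- Since φ vanishes at infinity, |φ(r)| is at most the integral of |φ'| over (r, ∞). Hölder's
inequality with the weights t^(b/p) and t^(-b/p) gives the bound; b > p - 1 makes the dual weight
t^(-b/(p-1)) integrable at infinity. -/
theorem enorm_le_weighted_lintegral_deriv {φ : ℝ → ℝ} (hφ : ContDiff ℝ 1 φ)
    (hφc : HasCompactSupport φ) {p b : ℝ} (hp : 1 < p) (hb : p - 1 < b) {r : ℝ} (hr : 0 < r) :
    ‖φ r‖ₑ ≤ (∫⁻ t in Ioi r, ENNReal.ofReal (t ^ b) * ‖deriv φ t‖ₑ ^ p) ^ (1 / p) *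
      ENNReal.ofReal (r ^ (1 - b / (p - 1)) / (b / (p - 1) - 1)) ^ (1 - 1 / p) := by
  have hp0 : 0 < p := by linarith
  have hp1 : 0 < p - 1 := by linarith
  set q := p / (p - 1) with hq
  have hpq : p.HolderConjugate q := Real.HolderConjugate.conjExponent hp
  have hq' : 1 / q = 1 - 1 / p := by
    rw [hq]
    field_simp
  have hdc : Continuous (deriv φ) := hφ.continuous_deriv (by simp)
  have h1 : ‖φ r‖ₑ ≤ ∫⁻ t in Ioi r, ‖deriv φ t‖ₑ := by
    rw [← enorm_neg, ← hφc.integral_Ioi_deriv_eq hφ r]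
    exact enorm_integral_le_lintegral_enorm _
  have h2 : ∫⁻ t in Ioi r, ‖deriv φ t‖ₑ = ∫⁻ t in Ioi r,
      ((fun t => ENNReal.ofReal (t ^ (b / p)) * ‖deriv φ t‖ₑ) *
        fun t => ENNReal.ofReal (t ^ (-(b / p)))) t := by
    refine setLIntegral_congr_fun measurableSet_Ioi fun t ht => ?_
    have ht0 : 0 < t := hr.trans ht
    simp only [Pi.mul_apply]
    rw [mul_right_comm, ← ENNReal.ofReal_mul (by positivity), ← Real.rpow_add ht0]
    simp
  have h3 := ENNReal.lintegral_mul_le_Lp_mul_Lq (volume.restrict (Ioi r)) hpq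
    (f := fun t => ENNReal.ofReal (t ^ (b / p)) * ‖deriv φ t‖ₑ)
    (g := fun t => ENNReal.ofReal (t ^ (-(b / p)))) (by fun_prop) (by fun_prop)
  have h4 : ∫⁻ t in Ioi r, (ENNReal.ofReal (t ^ (b / p)) * ‖deriv φ t‖ₑ) ^ p =
      ∫⁻ t in Ioi r, ENNReal.ofReal (t ^ b) * ‖deriv φ t‖ₑ ^ p := by
    refine setLIntegral_congr_fun measurableSet_Ioi fun t ht => ?_
    have ht0 : 0 < t := hr.trans ht
    rw [ENNReal.mul_rpow_of_nonneg _ _ hp0.le,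
      ENNReal.ofReal_rpow_of_nonneg (by positivity) hp0.le, ← Real.rpow_mul ht0.le,
      div_mul_cancel₀ _ hp0.ne']
  have ha : -(b / (p - 1)) < -1 := by
    rw [neg_lt_neg_iff, one_lt_div hp1]
    exact hb
  have h5 : ∫⁻ t in Ioi r, ENNReal.ofReal (t ^ (-(b / p))) ^ q =
      ENNReal.ofReal (r ^ (1 - b / (p - 1)) / (b / (p - 1) - 1)) := by
    calc _ = ∫⁻ t in Ioi r, ENNReal.ofReal (t ^ (-(b / (p - 1)))) := by
          refine setLIntegral_congr_fun measurableSet_Ioi fun t ht => ?_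
          have ht0 : 0 < t := hr.trans ht
          rw [ENNReal.ofReal_rpow_of_nonneg (by positivity) hpq.symm.nonneg,
            ← Real.rpow_mul ht0.le]
          congr 2
          rw [hq]
          field_simp
      _ = _ := by
          rw [← ofReal_integral_eq_lintegral_ofReal (integrableOn_Ioi_rpow_of_lt ha hr)
            ((ae_restrict_iff' measurableSet_Ioi).2 (Eventually.of_forall fun t ht =>
              Real.rpow_nonneg (hr.trans ht).le _)), integral_Ioi_rpow_of_lt ha hr]
          congr 1
          rw [neg_add_eq_sub, ← neg_sub (b / (p - 1)) 1, neg_div_neg_eq]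
  rw [h4, h5, hq'] at h3
  exact (h1.trans_eq h2).trans h3

/-- The one-dimensional estimate is applied to the profile of w along a ray with b = n - 1, the
power of the polar density; then b > p - 1 is the hypothesis p < n. -/
theorem exists_radial_const_of_contDiff {E : Type*} [NormedAddCommGroup E] [NormedSpace ℝ E]
    [FiniteDimensional ℝ E] [MeasurableSpace E] [BorelSpace E] (μ : Measure E) [μ.IsAddHaarMeasure]
    {p : ℝ} (hp : 1 < p) (hpE : p < Module.finrank ℝ E) :
    ∃ C : ℝ≥0, ∀ w : E → ℝ, ContDiff ℝ 1 w → HasCompactSupport w →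
      (∀ x y, ‖x‖ = ‖y‖ → w x = w y) → ∀ x, x ≠ 0 →
      ‖w x‖ₑ ≤ C * ENNReal.ofReal (‖x‖ ^ (-((Module.finrank ℝ E - p) / p))) *
        eLpNorm (fderiv ℝ w) (ENNReal.ofReal p) μ := by
  have hp0 : 0 < p := by linarith
  have hp1 : 0 < p - 1 := by linarith
  set n := Module.finrank ℝ E with hn
  have hn0 : 0 < n := by exact_mod_cast hp0.trans hpE
  have : Nontrivial E := Module.nontrivial_of_finrank_pos hn0
  set b : ℝ := ((n - 1 : ℕ) : ℝ) with hb
  have hbn : b = n - 1 := by rw [hb, Nat.cast_sub hn0, Nat.cast_one]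
  have hpb : p - 1 < b := by linarith
  have ha : 0 < b / (p - 1) - 1 := by
    rw [sub_pos, one_lt_div hp1]
    exact hpb
  have hp' : 0 ≤ 1 - 1 / p := by
    rw [sub_nonneg, div_le_one hp0]
    exact hp.le
  set σ := μ.toSphere univ with hσ
  have hσ0 : σ ≠ 0 := by
    rw [hσ, Ne, Measure.measure_univ_eq_zero]
    exact μ.toSphere_ne_zero
  have hσt : σ ≠ ⊤ := measure_ne_top _ _
  set C : ℝ≥0∞ := (σ⁻¹) ^ (1 / p) * ENNReal.ofReal (b / (p - 1) - 1)⁻¹ ^ (1 - 1 / p) with hC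
  have hCt : C ≠ ⊤ := by
    refine ENNReal.mul_ne_top ?_ ?_ <;> refine ENNReal.rpow_ne_top_of_nonneg (by positivity) ?_
    · simpa using hσ0
    · finiteness
  refine ⟨C.toNNReal, fun w hw hwc hrad x hx => ?_⟩
  rw [ENNReal.coe_toNNReal hCt]
  have hx0 : 0 < ‖x‖ := norm_pos_iff.2 hx
  set e : E := ‖x‖⁻¹ • x with he
  have he1 : ‖e‖ = 1 := norm_smul_inv_norm (𝕜 := ℝ) hx
  set φ : ℝ → ℝ := fun t => w (t • e) with hφdef
  have hφ : ContDiff ℝ 1 φ := hw.comp (contDiff_id.smul contDiff_const)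
  have hφc : HasCompactSupport φ := by
    refine hwc.comp_isClosedEmbedding (g := fun t : ℝ => t • e) ?_
    exact isClosedEmbedding_smul_left (norm_ne_zero_iff.1 (by rw [he1]; exact one_ne_zero))
  have hφw : ∀ y : E, ∀ t : ℝ, |t| = ‖y‖ → φ t = w y := fun y t ht =>
    hrad _ _ (by rw [norm_smul, he1, mul_one, Real.norm_eq_abs, ht])
  -- The profile is the same along every unit direction, so at radius ‖y‖ it may be differentiated
  -- along y itself.
  have hderiv : ∀ y : E, y ≠ 0 → ‖deriv φ ‖y‖‖ₑ ≤ ‖fderiv ℝ w y‖ₑ := by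
    intro y hy
    have hy0 : 0 < ‖y‖ := norm_pos_iff.2 hy
    set d : E := ‖y‖⁻¹ • y with hd
    have hd1 : ‖d‖ = 1 := norm_smul_inv_norm (𝕜 := ℝ) hy
    have hφd : φ = fun t => w (t • d) := by
      funext t
      exact hφw _ _ (by rw [norm_smul, hd1, mul_one, Real.norm_eq_abs])
    have hyd : ‖y‖ • d = y := by rw [hd, smul_smul, mul_inv_cancel₀ hy0.ne', one_smul]
    have h1 : HasDerivAt φ (fderiv ℝ w (‖y‖ • d) d) ‖y‖ := by
      rw [hφd]
      have h2 : HasDerivAt (fun t : ℝ => t • d) ((1 : ℝ) • d) ‖y‖ :=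
        (hasDerivAt_id ‖y‖).smul_const d
      rw [one_smul] at h2
      exact ((hw.differentiable (by simp)) (‖y‖ • d)).hasFDerivAt.comp_hasDerivAt ‖y‖ h2
    rw [h1.deriv, hyd, enorm_le_iff_norm_le]
    simpa [hd1] using (fderiv ℝ w y).le_opNorm d
  have hdc : Continuous (deriv φ) := hφ.continuous_deriv (by simp)
  have hpolar := lintegral_fun_norm μ (f := fun t => ‖deriv φ t‖ₑ ^ p) (by fun_prop)
  have hne : ∀ᵐ y ∂μ, y ≠ 0 := by simp [ae_iff]
  have hle : ∫⁻ t in Ioi ‖x‖, ENNReal.ofReal (t ^ b) * ‖deriv φ t‖ₑ ^ p ≤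
      σ⁻¹ * ∫⁻ y, ‖fderiv ℝ w y‖ₑ ^ p ∂μ := by
    calc _ ≤ ∫⁻ t in Ioi 0, ENNReal.ofReal (t ^ b) * ‖deriv φ t‖ₑ ^ p :=
          lintegral_mono_set (Ioi_subset_Ioi hx0.le)
      _ = σ⁻¹ * ∫⁻ y, ‖deriv φ ‖y‖‖ₑ ^ p ∂μ := by
          rw [hpolar, ← mul_assoc, ENNReal.inv_mul_cancel hσ0 hσt, one_mul]
          simp only [hb, Real.rpow_natCast, hn]
      _ ≤ _ := by
          refine mul_le_mul_right (lintegral_mono_ae ?_) _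
          filter_upwards [hne] with y hy
          exact ENNReal.rpow_le_rpow (hderiv y hy) hp0.le
  have hmain := enorm_le_weighted_lintegral_deriv hφ hφc hp hpb hx0
  rw [hφw x ‖x‖ (abs_norm x)] at hmain
  refine hmain.trans ((mul_le_mul_left (ENNReal.rpow_le_rpow hle (by positivity)) _).trans_eq ?_)
  rw [eLpNorm_eq_lintegral_rpow_enorm_toReal (by simpa using hp0) ENNReal.ofReal_ne_top,
    ENNReal.toReal_ofReal hp0.le, ENNReal.mul_rpow_of_nonneg _ _ (by positivity), div_eq_mul_inv
    (‖x‖ ^ _), ENNReal.ofReal_mul (by positivity), ENNReal.mul_rpow_of_nonneg _ _ hp',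
    ENNReal.ofReal_rpow_of_nonneg (by positivity) hp', ← Real.rpow_mul hx0.le]
  have hexp : (1 - b / (p - 1)) * (1 - 1 / p) = -((n - p) / p) := by
    rw [hbn]
    field_simp
    ring
  rw [hexp, hC]
  ring

/-- The pointwise decay estimate for radial functions of `D^{1,p}`. -/
theorem exists_radial_const (N : ℕ) {p : ℝ} (hp : 1 < p) (hpN : p < N) :
    ∃ C : ℝ≥0, ∀ u : EuclideanSpace ℝ (Fin N) → ℝ, MemD N p u → IsRadial u →
      ∀ᵐ x, ‖u x‖ₑ ≤ C * ENNReal.ofReal (‖x‖ ^ (-((N - p) / p))) *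
        eLpNorm (weakGradient u) (ENNReal.ofReal p) volume := by
  have hfin : Module.finrank ℝ (EuclideanSpace ℝ (Fin N)) = N := finrank_euclideanSpace_fin
  obtain ⟨C, hC⟩ := exists_radial_const_of_contDiff
    (volume : Measure (EuclideanSpace ℝ (Fin N))) hp (by rwa [hfin])
  rw [hfin] at hC
  refine ⟨C, fun u hu hrad => ?_⟩
  obtain ⟨w, hw1, hwc, hlim, hgrad, hwrad⟩ :=
    exists_approx hp hpN hu.1 (isWeakGradient_weakGradient hu.2.1)
  have : Nontrivial (EuclideanSpace ℝ (Fin N)) :=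
    Module.nontrivial_of_finrank_pos (R := ℝ) (by
      rw [hfin]
      exact_mod_cast (zero_lt_one.trans hp).trans hpN)
  have hne : ∀ᵐ y ∂(volume : Measure (EuclideanSpace ℝ (Fin N))), y ≠ 0 := by simp [ae_iff]
  filter_upwards [hlim, hne] with x hx hx0
  set c := C * ENNReal.ofReal (‖x‖ ^ (-((N - p) / p))) with hc
  have hct : c ≠ ⊤ := by finiteness
  have h := ENNReal.Tendsto.const_mul (a := c)
    ((tendsto_const_nhds (x := eLpNorm (weakGradient u) (ENNReal.ofReal p) volume)).add
      ENNReal.tendsto_inv_nat_nhds_zero) (Or.inr hct)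
  rw [add_zero] at h
  exact le_of_tendsto_of_tendsto' hx.enorm h fun n =>
    (hC (w n) (hw1 n) (hwc n) (hwrad hrad n) x hx0).trans (mul_le_mul_right (hgrad n) _)

/-! ### Hölder exponents and the estimate of the supremum. -/

/-- Admissible Hölder exponents: `V|h|^p`, `V|u|^p`, `|h|^{p^*}` and the weight are raised to the
powers `a₁`, `a₂`, `a₃`, `θ`, and a power `m` of `|u|` is left for the pointwise estimate. -/
theorem exists_holder_exponents {N : ℕ} {p α β q : ℝ} (hp : 1 < p) (hpN : p < N)
    (hβ₀ : 0 ≤ β) (hβ₁ : β ≤ 1) (hq : max 1 (p * β) < q) (hq' : q < qStar N p α β) :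
    ∃ a₁ a₂ a₃ θ m : ℝ, 0 ≤ a₁ ∧ 0 ≤ a₂ ∧ 0 ≤ a₃ ∧ 0 ≤ θ ∧ 0 ≤ m ∧ a₁ + a₂ + a₃ + θ = 1 ∧
      a₁ + a₂ = β ∧ p * a₁ + p * N / (N - p) * a₃ = 1 ∧ p * a₂ + m = q - 1 ∧
      0 < α - (N - p) / p * m + N * θ := by
  have hNp : 0 < (N : ℝ) - p := sub_pos.2 hpN
  have hp0 : 0 < p := by linarith
  have hN0 : (0 : ℝ) < N := by linarith
  obtain ⟨hq1, hqβ⟩ := max_lt_iff.1 hq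
  have hkey : (N - p) / p * q < α - p * β + N := by
    unfold qStar at hq'
    rw [← mul_div_assoc, lt_div_iff₀ hNp] at hq'
    rw [div_mul_eq_mul_div, div_lt_iff₀ hp0]
    linarith
  rcases le_total (p * β) 1 with h | h
  · have hβ : β ≤ 1 / p := by
      rw [le_div_iff₀ hp0]
      linarith
    -- Case pβ ≤ 1: all of V^β is paired with h, and the remaining power 1 - pβ of |h| goes to
    -- Sobolev's inequality, so a₃ = (1 - pβ)/p*. Since p* ≥ p, a₃ ≤ 1/p - β ≤ 1 - β, whence θ ≥ 0.
    refine ⟨β, 0, (1 - p * β) * ((N - p) / (p * N)), 1 - β - (1 - p * β) * ((N - p) / (p * N)),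
      q - 1, hβ₀, le_rfl, mul_nonneg (by linarith) (by positivity), ?_, by linarith, by ring,
      by ring, ?_, by ring, ?_⟩
    · have h1 : (1 - p * β) * ((N - p) / (p * N)) ≤ (1 - p * β) * (1 / p) := by
        refine mul_le_mul_of_nonneg_left ?_ (by linarith)
        rw [div_le_div_iff₀ (by positivity) hp0]
        nlinarith
      have h2 : (1 - p * β) * (1 / p) = 1 / p - β := by
        field_simp
      have h3 : 1 / p ≤ 1 := (div_le_one hp0).2 hp.le
      linarith
    · field_simp
      ring
    · have h1 : N * (1 - β - (1 - p * β) * ((N - p) / (p * N))) =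
          N - N * β - (1 - p * β) * ((N - p) / p) := by
        field_simp
      have h2 : (N - p) / p * (p * β) = N * β - p * β := by
        field_simp
      rw [h1]
      linarith
  · have hβ : 1 / p ≤ β := by
      rw [div_le_iff₀ hp0]
      linarith
    -- Case pβ ≥ 1: V^(1/p) already absorbs all of |h|, and the excess V^(β - 1/p) is paired with u,
    -- leaving m = q - pβ > 0.
    refine ⟨1 / p, β - 1 / p, 0, 1 - β, q - p * β, by positivity, by linarith, le_rfl, by linarith,
      by linarith, by ring, by ring, ?_, ?_, ?_⟩
    · field_simp
      ring
    · field_simp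
      ring
    · have h2 : (N - p) / p * (p * β) = N * β - p * β := by
        field_simp
      linarith

theorem eLpNorm_weakGradient_le_one {N : ℕ} {p : ℝ} (hp : 0 < p) {V : ℝ → ℝ≥0∞}
    {u : EuclideanSpace ℝ (Fin N) → ℝ} (hu : normW N p V u = 1) :
    eLpNorm (weakGradient u) (ENNReal.ofReal p) volume ≤ 1 := by
  rw [← hu, normW, eLpNorm_eq_lintegral_rpow_enorm_toReal (by simpa using hp)
    ENNReal.ofReal_ne_top, ENNReal.toReal_ofReal hp.le]
  exact ENNReal.rpow_le_rpow (lintegral_mono fun x => le_self_add) (by positivity)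

theorem lintegral_potential_le_one {N : ℕ} {p : ℝ} (hp : 0 < p) {V : ℝ → ℝ≥0∞}
    {u : EuclideanSpace ℝ (Fin N) → ℝ} (hu : normW N p V u = 1) :
    ∫⁻ x, V ‖x‖ * ‖u x‖ₑ ^ p ≤ 1 := by
  have h1 : ∫⁻ x, (‖weakGradient u x‖ₑ ^ p + V ‖x‖ * ‖u x‖ₑ ^ p) ≤ 1 := by
    have h2 := hu.le
    rwa [normW, one_div, ENNReal.rpow_inv_le_iff hp, ENNReal.one_rpow] at h2
  exact (lintegral_mono fun x => le_add_self).trans h1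

/-- The bound on `K / (r^α V^β)` as a pointwise bound on the ball. -/
theorem exists_weight_bound {N : ℕ} (hN : 0 < N) {V : ℝ → ℝ≥0∞} {K : ℝ → ℝ}
    {R₁ : ℝ} (hVfin : ∀ᵐ r ∂(volume.restrict (Ioo 0 R₁)), V r < ⊤)
    {α β : ℝ} (hβ : 0 ≤ β)
    (hess : essSup (fun r : ℝ => ENNReal.ofReal (K r) / (ENNReal.ofReal (r ^ α) * V r ^ β))
      (volume.restrict (Ioo 0 R₁)) < ⊤) :
    ∃ Λ : ℝ≥0, ∀ᵐ x : EuclideanSpace ℝ (Fin N), ‖x‖ < R₁ →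
      ENNReal.ofReal (K ‖x‖) ≤ Λ * (ENNReal.ofReal (‖x‖ ^ α) * V ‖x‖ ^ β) := by
  lift essSup (fun r : ℝ => ENNReal.ofReal (K r) / (ENNReal.ofReal (r ^ α) * V r ^ β))
      (volume.restrict (Ioo 0 R₁)) to ℝ≥0 using hess.ne with Λ hΛ
  have hfin : Module.finrank ℝ (EuclideanSpace ℝ (Fin N)) = N := finrank_euclideanSpace_fin
  have : Nontrivial (EuclideanSpace ℝ (Fin N)) :=
    Module.nontrivial_of_finrank_pos (R := ℝ) (by rwa [hfin])
  have hle := ENNReal.ae_le_essSup (μ := volume.restrict (Ioo 0 R₁))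
    (fun r : ℝ => ENNReal.ofReal (K r) / (ENNReal.ofReal (r ^ α) * V r ^ β))
  have hae := (hVfin.and hle)
  rw [ae_restrict_iff' measurableSet_Ioo] at hae
  have hae' := (quasiMeasurePreserving_norm (volume : Measure (EuclideanSpace ℝ (Fin N)))).ae
    (ae_restrict_of_ae (s := Ioi 0) hae)
  have hne : ∀ᵐ y ∂(volume : Measure (EuclideanSpace ℝ (Fin N))), y ≠ 0 := by simp [ae_iff]
  refine ⟨Λ, ?_⟩
  filter_upwards [hae', hne] with x hx hx0 hxR
  have hx0' : 0 < ‖x‖ := norm_pos_iff.2 hx0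
  obtain ⟨hV, hK'⟩ := hx ⟨hx0', hxR⟩
  rw [← hΛ] at hK'
  -- Where the denominator vanishes, finiteness of Λ forces the numerator to vanish as well.
  -- Finiteness of V excludes an infinite denominator, for which the quotient would say nothing.
  refine (ENNReal.div_le_iff_le_mul (Or.inr ENNReal.coe_ne_top) (Or.inl ?_)).1 hK'
  exact ENNReal.mul_ne_top ENNReal.ofReal_ne_top (ENNReal.rpow_ne_top_of_nonneg hβ hV.ne)

theorem lintegral_ball_norm_rpow_lt_top {N : ℕ} (hN : 0 < N) {s : ℝ} (hs : 0 < s) (R : ℝ) :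
    ∫⁻ x in Metric.ball (0 : EuclideanSpace ℝ (Fin N)) R, ENNReal.ofReal (‖x‖ ^ (s - N)) < ⊤ := by
  have hfin : Module.finrank ℝ (EuclideanSpace ℝ (Fin N)) = N := finrank_euclideanSpace_fin
  have h : IntegrableOn (fun x : EuclideanSpace ℝ (Fin N) => ‖x‖ ^ (s - N)) (Metric.ball 0 R) :=
    integrableOn_ball_of_norm_le_rpow (C := 1) (α := N - s) (by rw [hfin]; exact hN)
      (by rw [hfin]; linarith) (Eventually.of_forall fun x => by
        rw [Real.norm_of_nonneg (by positivity), one_mul, neg_sub])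
      (measurable_norm.pow_const _).aestronglyMeasurable
  exact h.lintegral_lt_top

/-- The bound on `R_0` by a power of `R`. -/
theorem exists_R0_le {N : ℕ} {p : ℝ} (hp : 1 < p) (hpN : p < N)
    {V : ℝ → ℝ≥0∞} {K : ℝ → ℝ} (hV : CondV V) {R₁ : ℝ}
    (hVfin : ∀ᵐ r ∂(volume.restrict (Ioo 0 R₁)), V r < ⊤)
    {α β : ℝ} (hβ₀ : 0 ≤ β) (hβ₁ : β ≤ 1)
    (hess : essSup (fun r : ℝ => ENNReal.ofReal (K r) / (ENNReal.ofReal (r ^ α) * V r ^ β))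
      (volume.restrict (Ioo 0 R₁)) < ⊤)
    {q : ℝ} (hq : max 1 (p * β) < q) (hq' : q < qStar N p α β) :
    ∃ (δ : ℝ) (B : ℝ≥0∞), 0 < δ ∧ B ≠ ⊤ ∧
      ∀ R : ℝ, R ≤ R₁ → R0 N p V K q R ≤ B * ENNReal.ofReal (R ^ δ) := by
  have hNp : 0 < (N : ℝ) - p := sub_pos.2 hpN
  have hp0 : 0 < p := by linarith
  have hN0 : (0 : ℝ) < N := by linarith
  have hN : 0 < N := by exact_mod_cast hN0
  have hfin : Module.finrank ℝ (EuclideanSpace ℝ (Fin N)) = N := finrank_euclideanSpace_fin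
  have : Nontrivial (EuclideanSpace ℝ (Fin N)) :=
    Module.nontrivial_of_finrank_pos (R := ℝ) (by rwa [hfin])
  obtain ⟨a₁, a₂, a₃, θ, m, ha₁, ha₂, ha₃, hθ, hm, hsum, hVexp, hhexp, huexp, hκ⟩ :=
    exists_holder_exponents hp hpN hβ₀ hβ₁ hq hq'
  set ν : ℝ := (N - p) / p with hν
  set P : ℝ := p * N / (N - p) with hP
  have hP0 : 0 < P := by positivity
  set κ : ℝ := α - ν * m + N * θ with hκdef
  -- Half of κ keeps ‖x‖^(s-N) integrable near 0. As θ ≤ 1, the exponent κ - sθ left for R is still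
  -- positive, and θ = 0 needs no separate treatment.
  set s : ℝ := κ / 2 with hs
  have hs0 : 0 < s := by positivity
  have hθ1 : θ ≤ 1 := by linarith
  obtain ⟨Λ, hΛ⟩ := exists_weight_bound (N := N) hN hVfin hβ₀ hess
  obtain ⟨S, hS⟩ := exists_sobolev_const N hp hpN
  obtain ⟨C, hC⟩ := exists_radial_const N hp hpN
  set I := ∫⁻ x in Metric.ball (0 : EuclideanSpace ℝ (Fin N)) R₁,
    ENNReal.ofReal (‖x‖ ^ (s - N)) with hI
  have hIt : I ≠ ⊤ := (lintegral_ball_norm_rpow_lt_top hN hs0 R₁).ne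
  have hVm : AEMeasurable (fun x : EuclideanSpace ℝ (Fin N) => V ‖x‖) :=
    hV.1.comp_quasiMeasurePreserving (quasiMeasurePreserving_norm volume)
  have hδ : 0 < κ - s * θ := by nlinarith
  refine ⟨κ - s * θ, Λ * C ^ m * (((S : ℝ≥0∞) ^ P) ^ a₃ * I ^ θ), hδ, ?_, fun R hR => ?_⟩
  · have h1 : (C : ℝ≥0∞) ^ m ≠ ⊤ := ENNReal.rpow_ne_top_of_nonneg hm ENNReal.coe_ne_top
    have h2 : ((S : ℝ≥0∞) ^ P) ^ a₃ ≠ ⊤ := ENNReal.rpow_ne_top_of_nonneg ha₃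
      (ENNReal.rpow_ne_top_of_nonneg hP0.le ENNReal.coe_ne_top)
    have h3 : I ^ θ ≠ ⊤ := ENNReal.rpow_ne_top_of_nonneg hθ hIt
    finiteness
  refine iSup₂_le fun u hu => iSup₂_le fun h hh => iSup_le fun ⟨hu1, hh1⟩ => ?_
  have hum : AEMeasurable fun x => ‖u x‖ₑ := hu.1.1.1.1.enorm
  have hhm : AEMeasurable fun x => ‖h x‖ₑ := hh.1.1.1.enorm
  have hsob : ∫⁻ x, ‖h x‖ₑ ^ P ≤ (S : ℝ≥0∞) ^ P := by
    have h1 := (hS h hh.1).trans (mul_le_mul_right (eLpNorm_weakGradient_le_one hp0 hh1) _)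
    rw [eLpNorm_eq_lintegral_rpow_enorm_toReal (by simpa using hP0) ENNReal.ofReal_ne_top,
      ENNReal.toReal_ofReal hP0.le, mul_one, one_div, ENNReal.rpow_inv_le_iff hP0] at h1
    exact h1
  have hrad : ∀ᵐ x, ‖u x‖ₑ ≤ C * ENNReal.ofReal (‖x‖ ^ (-ν)) := by
    filter_upwards [hC u hu.1.1 hu.2] with x hx
    refine (hx.trans (mul_le_mul_right (eLpNorm_weakGradient_le_one hp0 hu1) _)).trans_eq ?_
    rw [mul_one]
  have hne : ∀ᵐ y ∂(volume : Measure (EuclideanSpace ℝ (Fin N))), y ≠ 0 := by simp [ae_iff]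
  have hpt : ∀ᵐ x ∂(volume.restrict (Metric.ball (0 : EuclideanSpace ℝ (Fin N)) R)),
      ENNReal.ofReal (K ‖x‖) * ‖u x‖ₑ ^ (q - 1) * ‖h x‖ₑ ≤
        Λ * C ^ m * ENNReal.ofReal (R ^ (κ - s * θ)) *
          ((V ‖x‖ * ‖h x‖ₑ ^ p) ^ a₁ * (V ‖x‖ * ‖u x‖ₑ ^ p) ^ a₂ * (‖h x‖ₑ ^ P) ^ a₃ *
            ENNReal.ofReal (‖x‖ ^ (s - N)) ^ θ) := by
    rw [ae_restrict_iff' measurableSet_ball]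
    filter_upwards [hΛ, hrad, hne] with x hx1 hx2 hx0 hxR
    rw [mem_ball_zero_iff] at hxR
    have hr : 0 < ‖x‖ := norm_pos_iff.2 hx0
    have hum' : ‖u x‖ₑ ^ m ≤ C ^ m * ENNReal.ofReal (‖x‖ ^ (-(ν * m))) := by
      refine (ENNReal.rpow_le_rpow hx2 hm).trans_eq ?_
      rw [ENNReal.mul_rpow_of_nonneg _ _ hm, ENNReal.ofReal_rpow_of_nonneg (by positivity) hm,
        ← Real.rpow_mul hr.le, neg_mul]
    -- Here α - νm = κ - Nθ = (κ - sθ) + (s - N)θ, and the first power is increasing in ‖x‖ < R.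
    have hw : ENNReal.ofReal (‖x‖ ^ α) * ENNReal.ofReal (‖x‖ ^ (-(ν * m))) ≤
        ENNReal.ofReal (R ^ (κ - s * θ)) * ENNReal.ofReal (‖x‖ ^ (s - N)) ^ θ := by
      rw [ENNReal.ofReal_rpow_of_nonneg (by positivity) hθ, ← Real.rpow_mul hr.le,
        ← ENNReal.ofReal_mul (by positivity), ← ENNReal.ofReal_mul
          (Real.rpow_nonneg (hr.trans hxR).le _), ← Real.rpow_add hr]
      refine ENNReal.ofReal_le_ofReal ?_
      calc ‖x‖ ^ (α + -(ν * m)) = ‖x‖ ^ (κ - s * θ) * ‖x‖ ^ ((s - N) * θ) := by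
            rw [← Real.rpow_add hr]
            congr 1
            rw [hκdef]
            ring
        _ ≤ _ := mul_le_mul_of_nonneg_right (Real.rpow_le_rpow hr.le hxR.le hδ.le) (by positivity)
    have hVβ : V ‖x‖ ^ β = V ‖x‖ ^ a₁ * V ‖x‖ ^ a₂ := by
      rw [← hVexp, ENNReal.rpow_add_of_nonneg _ _ ha₁ ha₂]
    have hu' : ‖u x‖ₑ ^ (q - 1) = (‖u x‖ₑ ^ p) ^ a₂ * ‖u x‖ₑ ^ m := by
      rw [← huexp, ENNReal.rpow_add_of_nonneg _ _ (by positivity) hm, ENNReal.rpow_mul]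
    have hh' : ‖h x‖ₑ = (‖h x‖ₑ ^ p) ^ a₁ * (‖h x‖ₑ ^ P) ^ a₃ := by
      rw [← ENNReal.rpow_mul, ← ENNReal.rpow_mul, ← ENNReal.rpow_add_of_nonneg _ _
        (by positivity) (by positivity), hhexp, ENNReal.rpow_one]
    calc _ ≤ Λ * (ENNReal.ofReal (‖x‖ ^ α) * V ‖x‖ ^ β) * ‖u x‖ₑ ^ (q - 1) * ‖h x‖ₑ := by
          gcongr
          exact hx1 (hxR.trans_le hR)
      _ = Λ * (V ‖x‖ ^ a₁ * (‖h x‖ₑ ^ p) ^ a₁) * (V ‖x‖ ^ a₂ * (‖u x‖ₑ ^ p) ^ a₂) *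
            (‖h x‖ₑ ^ P) ^ a₃ * ENNReal.ofReal (‖x‖ ^ α) * ‖u x‖ₑ ^ m := by
          nth_rw 1 [hh']
          rw [hVβ, hu']
          ring
      _ ≤ Λ * (V ‖x‖ ^ a₁ * (‖h x‖ₑ ^ p) ^ a₁) * (V ‖x‖ ^ a₂ * (‖u x‖ₑ ^ p) ^ a₂) *
            (‖h x‖ₑ ^ P) ^ a₃ * ENNReal.ofReal (‖x‖ ^ α) *
            (C ^ m * ENNReal.ofReal (‖x‖ ^ (-(ν * m)))) := by gcongr
      _ = Λ * C ^ m * (V ‖x‖ ^ a₁ * (‖h x‖ₑ ^ p) ^ a₁) * (V ‖x‖ ^ a₂ * (‖u x‖ₑ ^ p) ^ a₂) *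
            (‖h x‖ₑ ^ P) ^ a₃ *
            (ENNReal.ofReal (‖x‖ ^ α) * ENNReal.ofReal (‖x‖ ^ (-(ν * m)))) := by ring
      _ ≤ Λ * C ^ m * (V ‖x‖ ^ a₁ * (‖h x‖ₑ ^ p) ^ a₁) * (V ‖x‖ ^ a₂ * (‖u x‖ₑ ^ p) ^ a₂) *
            (‖h x‖ₑ ^ P) ^ a₃ *
            (ENNReal.ofReal (R ^ (κ - s * θ)) * ENNReal.ofReal (‖x‖ ^ (s - N)) ^ θ) := by gcongr
      _ = _ := by
          rw [ENNReal.mul_rpow_of_nonneg _ _ ha₁, ENNReal.mul_rpow_of_nonneg _ _ ha₂]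
          ring
  -- This form of Hölder's inequality allows zero exponents, which occur in both choices of a₁, a₂,
  -- a₃, θ.
  have hholder := ENNReal.lintegral_prod_norm_pow_le
    (μ := volume.restrict (Metric.ball (0 : EuclideanSpace ℝ (Fin N)) R)) Finset.univ
    (f := ![fun x => V ‖x‖ * ‖h x‖ₑ ^ p, fun x => V ‖x‖ * ‖u x‖ₑ ^ p, fun x => ‖h x‖ₑ ^ P,
      fun x => ENNReal.ofReal (‖x‖ ^ (s - N))]) (p := ![a₁, a₂, a₃, θ])
    (by
      intro i _
      fin_cases i
      · exact (hVm.mul (hhm.pow_const p)).restrict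
      · exact (hVm.mul (hum.pow_const p)).restrict
      · exact (hhm.pow_const P).restrict
      · exact (measurable_norm.pow_const _).ennreal_ofReal.aemeasurable)
    (by simpa [Fin.sum_univ_four] using hsum)
    (by
      intro i _
      fin_cases i <;> assumption)
  simp only [Fin.prod_univ_four, Matrix.cons_val] at hholder
  have hh2 : ∫⁻ x in Metric.ball 0 R, V ‖x‖ * ‖h x‖ₑ ^ p ≤ 1 :=
    (setLIntegral_le_lintegral _ _).trans (lintegral_potential_le_one hp0 hh1)
  have hu2 : ∫⁻ x in Metric.ball 0 R, V ‖x‖ * ‖u x‖ₑ ^ p ≤ 1 :=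
    (setLIntegral_le_lintegral _ _).trans (lintegral_potential_le_one hp0 hu1)
  have hh3 : ∫⁻ x in Metric.ball 0 R, ‖h x‖ₑ ^ P ≤ (S : ℝ≥0∞) ^ P :=
    (setLIntegral_le_lintegral _ _).trans hsob
  have hI' : ∫⁻ x in Metric.ball (0 : EuclideanSpace ℝ (Fin N)) R,
      ENNReal.ofReal (‖x‖ ^ (s - N)) ≤ I := lintegral_mono_set (Metric.ball_subset_ball hR)
  have hct : Λ * (C : ℝ≥0∞) ^ m * ENNReal.ofReal (R ^ (κ - s * θ)) ≠ ⊤ := by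
    have h1 : (C : ℝ≥0∞) ^ m ≠ ⊤ := ENNReal.rpow_ne_top_of_nonneg hm ENNReal.coe_ne_top
    finiteness
  refine (lintegral_mono_ae hpt).trans ?_
  rw [lintegral_const_mul' _ _ hct]
  calc _ ≤ Λ * C ^ m * ENNReal.ofReal (R ^ (κ - s * θ)) *
        (1 ^ a₁ * 1 ^ a₂ * ((S : ℝ≥0∞) ^ P) ^ a₃ * I ^ θ) := by
        gcongr
        refine hholder.trans ?_
        gcongr
    _ = _ := by
        rw [ENNReal.one_rpow, ENNReal.one_rpow]
        ring

end WeightedRadial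
end

theorem mainTheorem2 (N : ℕ) (p : ℝ) (hp : 1 < p) (hpN : p < N)
    (V : ℝ → ℝ≥0∞) (K : ℝ → ℝ) (hV : WeightedRadial.CondV V) (hK : WeightedRadial.CondK K)
    (R₁ : ℝ) (hR₁ : 0 < R₁) (hVfin : ∀ᵐ r ∂(volume.restrict (Ioo 0 R₁)), V r < ⊤)
    (α₀ β₀ : ℝ) (hβ₀ : 0 ≤ β₀) (hβ₁ : β₀ ≤ 1) (hα₀ : WeightedRadial.alphaStar N p β₀ < α₀)
    (hess : essSup (fun r : ℝ =>
        ENNReal.ofReal (K r) / (ENNReal.ofReal (r ^ α₀) * V r ^ β₀))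
        (volume.restrict (Ioo 0 R₁)) < ⊤)
    (q₁ : ℝ) (hq₁ : max 1 (p * β₀) < q₁) (hq₁' : q₁ < WeightedRadial.qStar N p α₀ β₀) :
    Tendsto (fun R : ℝ => WeightedRadial.R0 N p V K q₁ R) (𝓝[>] 0) (𝓝 0) := by
  obtain ⟨δ, B, hδ, hB, hle⟩ :=
    WeightedRadial.exists_R0_le hp hpN hV hVfin hβ₀ hβ₁ hess hq₁ hq₁'
  have hpow : Tendsto (fun R : ℝ => ENNReal.ofReal (R ^ δ)) (𝓝[>] 0) (𝓝 0) := by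
    have h := ((Real.continuousAt_rpow_const 0 δ (Or.inr hδ.le)).tendsto).mono_left
      (nhdsWithin_le_nhds (s := Ioi 0))
    rw [Real.zero_rpow hδ.ne'] at h
    simpa using ENNReal.tendsto_ofReal h
  have hlim := ENNReal.Tendsto.const_mul (a := B) hpow (Or.inr hB)
  rw [mul_zero] at hlim
  refine tendsto_of_tendsto_of_tendsto_of_le_of_le' tendsto_const_nhds hlim
    (Eventually.of_forall fun _ => zero_le) ?_
  filter_upwards [Ioo_mem_nhdsGT hR₁] with R hR
  exact hle R hR.2.le
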